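/- For every integer $\nu\ge 2$ let $p_\nu\in(0,1)$ be an edge probability; it may vary with $\nu$ in an arbitrary way. Put $n=n_\nu:=\binom{\nu}{2}$ and $\rho=\rho_\nu:=\max\{p_\nu,1-p_\nu\}$. Identify the simple graphs on $\nu$ labelled vertices with the points of the hypercube $\{0,1\}^n$, one coordinate for each potential edge, and let $\pi_\nu(x)=p_\nu^{S(x)}(1-p_\nu)^{n-S(x)}$, where $S(x)$ is the number of ones of $x$ (the Erdős–Rényi model). The lazy random walk Metropolis chain for $\pi_\nu$ moves as follows: from $x$, with probability $1/2$ stay at $x$; otherwise choose one of the $n$ coordinates uniformly at random, let $y$ be $x$ with that coordinate flipped, and move to $y$ with probability $\min\{1,\pi_\nu(y)/\pi_\nu(x)\}$, else stay at $x$. Let $P_\nu$ be its transition matrix, let $$d_\nu(t)=\max_{x}\max_{A\subset\{0,1\}^n}\bigl(P_\nu^t(x,A)-\pi_\nu(A)\bigr),\qquad t_{\rm mix}^{(\nu)}(\varepsilon)=\min\{t\ge 0: d_\nu(t)\le\varepsilon\},\qquad t_{\rm mix}^{(\nu)}=t_{\rm mix}^{(\nu)}(1/4),$$ where $d_\nu$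 is evaluated at a real time by rounding down (negative times count as $0$). Then, as $\nu\to\infty$, this sequence of chains has a cutoff at $$T_\nu:=2\rho\, n\,\min\left\{\log n,\ \log\sqrt{\frac{n\rho}{1-\rho}}\right\}$$ with a window of size $n$. That is, for every $\varepsilon\in(0,1)$, $$\lim_{\nu\to\infty}\frac{t_{\rm mix}^{(\nu)}(\varepsilon)}{t_{\rm mix}^{(\nu)}(1-\varepsilon)}=1,$$ and, both for $c_\nu=t_{\rm mix}^{(\nu)}$ and for $c_\nu=T_\nu$, one has $n_\nu=o(c_\nu)$, $$\lim_{\alpha\to\infty}\liminf_{\nu\to\infty} d_\nu(c_\nu-\alpha n_\nu)=1\qquad\text{and}\qquad \lim_{\alpha\to\infty}\limsup_{\nu\to\infty} d_\nu(c_\nu+\alpha n_\nu)=0 .$$ -/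

import Mathlib

open Filter Topology Asymptotics

noncomputable section

/-- Total variation distance of two mass functions on a finite set: the maximum of
`μ(A) - π(A)` over all events `A`. -/
def tvDist {X : Type*} [Fintype X] (μ π : X → ℝ) : ℝ :=
  ⨆ A : Finset X, (∑ y ∈ A, μ y - ∑ y ∈ A, π y)

/-- Total variation distance to `π`, from the worst starting point, after `t` steps of the chain
with transition matrix `P`. -/
def worstDist {X : Type*} [Fintype X] [DecidableEq X] (P : Matrix X X ℝ) (π : X → ℝ)
    (t : ℕ) : ℝ :=
  ⨆ x : X, tvDist ((P ^ t) x) π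

/-- The mixing time `min {t ≥ 0 : d t ≤ ε}`. -/
def mixingTime (d : ℕ → ℝ) (ε : ℝ) : ℕ := sInf {t : ℕ | d t ≤ ε}

/-- The non-lazy random walk Metropolis chain for `π` on the hypercube `ι → Bool`, of dimension
`n = Fintype.card ι`: flip a uniformly chosen coordinate, and accept the new state `y` with
probability `min (1, π(y) / π(x))`; otherwise stay at `x`. -/
def metropolis {ι : Type*} [Fintype ι] [DecidableEq ι] (π : (ι → Bool) → ℝ) :
    Matrix (ι → Bool) (ι → Bool) ℝ :=
  fun x y =>
    if hammingDist x y = 1 then 1 / (Fintype.card ι : ℝ) * min 1 (π y / π x)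
    else if x = y then
      1 - ∑ z : ι → Bool with hammingDist x z = 1,
        1 / (Fintype.card ι : ℝ) * min 1 (π z / π x)
    else 0

/-- The lazy random walk Metropolis chain: with probability `1/2` stay put, otherwise make a
Metropolis step. -/
def lazyMetropolis {ι : Type*} [Fintype ι] [DecidableEq ι] (π : (ι → Bool) → ℝ) :
    Matrix (ι → Bool) (ι → Bool) ℝ :=
  (1 / 2 : ℝ) • (1 + metropolis π)

/-- The potential edges of a simple graph on the vertices `0, …, ν - 1`; there are `ν.choose 2` of
them. A function `PotentialEdge ν → Bool` is a simple graph on these vertices: the value `true`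
indicates that the edge is present. -/
abbrev PotentialEdge (ν : ℕ) : Type := {e : Sym2 (Fin ν) // ¬ e.IsDiag}

/-- The number `S(x)` of edges that are present in `x`. -/
def numEdges {ν : ℕ} (x : PotentialEdge ν → Bool) : ℕ :=
  (Finset.univ.filter fun e => x e = true).card

/-- The Erdős–Rényi random graph model on `ν` vertices with edge probability `p`. -/
def erdosRenyi (ν : ℕ) (p : ℝ) (x : PotentialEdge ν → Bool) : ℝ :=
  p ^ numEdges x * (1 - p) ^ (ν.choose 2 - numEdges x)

/-- The distance to stationarity of the lazy Metropolis chain for the Erdős–Rényi model. -/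
def erdosRenyiDist (ν : ℕ) (p : ℝ) (t : ℕ) : ℝ :=
  worstDist (lazyMetropolis (erdosRenyi ν p)) (erdosRenyi ν p) t

/-- A sequence of chains with distances to stationarity `d ν` has a cutoff. -/
def HasCutoff (d : ℕ → ℕ → ℝ) : Prop :=
  ∀ ε : ℝ, 0 < ε → ε < 1 →
    Tendsto (fun ν => (mixingTime (d ν) ε : ℝ) / (mixingTime (d ν) (1 - ε) : ℝ)) atTop (𝓝 1)

/-- The distances `d ν` drop from one to zero around the times `T ν`, on the scale `w ν = o(T ν)`.
Real times are rounded down, and negative times count as time zero. -/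
def DropsAt (d : ℕ → ℕ → ℝ) (T w : ℕ → ℝ) : Prop :=
  w =o[atTop] T ∧
  Tendsto (fun α : ℝ => liminf (fun ν => d ν ⌊T ν - α * w ν⌋₊) atTop) atTop (𝓝 1) ∧
  Tendsto (fun α : ℝ => limsup (fun ν => d ν ⌊T ν + α * w ν⌋₊) atTop) atTop (𝓝 0)

/-- Cutoff at `T ν` with a window of size `w ν`: there is a cutoff; its window, centred at the
mixing time (with parameter `1/4`), has size `w ν`; and the same holds with the centre `T ν`. -/
def HasCutoffAtWithWindow (d : ℕ → ℕ → ℝ) (T w : ℕ → ℝ) : Prop :=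
  HasCutoff d ∧ DropsAt d (fun ν => (mixingTime (d ν) (1 / 4) : ℝ)) w ∧ DropsAt d T w

end

/-!
The Metropolis chain for a product of Bernoulli measures is a resampling chain in disguise: with
`ρ = max p (1 - p)`, the acceptance probability of a flip to the bit `b` is the stationary mass of
`b`, divided by `ρ`. So one lazy step resamples each of the `n` coordinates from its stationary
distribution with probability `u = 1 / (2ρn)`, and does nothing otherwise
(`BernoulliCube.lazyMetropolis_mulVec`). Hence the products over `S` of the centred coordinates are
eigenfunctions, with eigenvalues `1 - |S|u ≥ 0`, and they diagonalize the chain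
(`BernoulliCube.pow_apply`).

Upper bounds. The spectral expansion bounds the squared `L²` distance to stationarity by
`exp (n r exp (-2tu)) - 1`, where `r = ρ / (1 - ρ)`; this is small once `tu` exceeds `log √(nr)` by
a large constant (`BernoulliCube.worstDist_le_sqrt`). On the other hand, every step contracts the
oscillation of a function along a coordinate by the factor `1 - u`, which bounds the distance by
`n (1 - u) ^ t`; this is small once `tu` exceeds `log n` by a large constant
(`BernoulliCube.worstDist_le_card_mul_pow`). The better of the two bounds gives the minimum in the
cutoff time.

Lower bound. Started from the state all of whose coordinates take their less likely value, the sum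
of the centred coordinates has mean of modulus `M = nρ (1 - u) ^ t`, and variance at most
`n p (1 - p) + M`, since the coordinates are negatively correlated. By Chebyshev's inequality it
separates the law of the chain from the stationary one as long as both `M` and
`M / √(n p (1 - p))` are large (`BernoulliCube.one_sub_le_worstDist`), which is the case until a
large multiple of `n` steps before the same minimum.

Such two-sided bounds, for distances that decrease in time, place every mixing time within a
bounded number of windows of the cutoff time, and this gives all three parts of the claim
(`SharpTransition.hasCutoffAtWithWindow`).
-/

/-! ### The Bernoulli product measure and the walk -/

namespace BernoulliCube

/-- The mass function of the Bernoulli distribution with success probability `p`. -/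
def bit (p : ℝ) (b : Bool) : ℝ := if b then p else 1 - p

/-- The centred coordinate function: the indicator of `true`, minus its mean `p`. -/
def centred (p : ℝ) (b : Bool) : ℝ := if b then 1 - p else -p

variable {ι : Type*} [Fintype ι] [DecidableEq ι]

/-- The mass function of independent Bernoulli variables with success probability `p`. -/
def cubeMass (ι : Type*) [Fintype ι] (p : ℝ) (x : ι → Bool) : ℝ := ∏ i, bit p (x i)

/-- The conditional expectation of `f` given all coordinates but `i`, as an operator: resample
coordinate `i` from its stationary distribution. -/
def resample (p : ℝ) (i : ι) (f : (ι → Bool) → ℝ) (x : ι → Bool) : ℝ :=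
  ∑ b, bit p b * f (Function.update x i b)

/-- The probability that a given coordinate is resampled in one step of the lazy chain. -/
noncomputable def resampleRate (ι : Type*) [Fintype ι] (p : ℝ) : ℝ :=
  (2 * max p (1 - p) * (Fintype.card ι : ℝ))⁻¹

/-- The (unnormalized) product character indexed by `S`. -/
def walsh (p : ℝ) (S : Finset ι) (x : ι → Bool) : ℝ := ∏ i ∈ S, centred p (x i)

lemma sum_bit (p : ℝ) : ∑ b, bit p b = 1 := by simp [bit]

lemma bit_pos {p : ℝ} (h0 : 0 < p) (h1 : p < 1) (b : Bool) : 0 < bit p b := by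
  cases b <;> simp [bit, h0, h1]

omit [DecidableEq ι] in
lemma cubeMass_pos {p : ℝ} (h0 : 0 < p) (h1 : p < 1) (x : ι → Bool) : 0 < cubeMass ι p x :=
  Finset.prod_pos fun _ _ => bit_pos h0 h1 _

lemma sum_prod_eq (F : ι → Bool → ℝ) :
    ∑ x : ι → Bool, ∏ i, F i (x i) = ∏ i, ∑ b, F i b := by
  rw [Fintype.prod_sum]

lemma sum_cubeMass (p : ℝ) : ∑ x, cubeMass ι p x = 1 := by
  simp only [cubeMass]
  rw [sum_prod_eq fun _ => bit p]
  simp only [sum_bit, Finset.prod_const_one]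

lemma max_pos {p : ℝ} (h0 : 0 < p) : 0 < max p (1 - p) := lt_max_of_lt_left h0

lemma half_le_max (p : ℝ) : 1 / 2 ≤ max p (1 - p) := by
  rcases le_total (1 / 2) p with h | h
  · exact h.trans (le_max_left _ _)
  · exact le_trans (by linarith) (le_max_right _ _)

/-- The neighbours of `x` in the cube are the points obtained by flipping one coordinate. -/
lemma sum_hammingDist_one (x : ι → Bool) (F : (ι → Bool) → ℝ) :
    ∑ z : ι → Bool with hammingDist x z = 1, F z = ∑ i, F (Function.update x i (!x i)) := by
  symm
  refine Finset.sum_nbij (fun i => Function.update x i (!x i)) ?_ ?_ ?_ fun _ _ => rfl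
  · intro i _
    have : (Finset.univ.filter fun j => x j ≠ Function.update x i (!x i) j) = {i} := by
      ext j
      by_cases hj : j = i
      · subst hj; simp
      · simp [hj]
    simp [hammingDist, this]
  · intro i _ j _ hij
    by_contra hne
    have := congrFun hij i
    simp [Function.update_of_ne hne] at this
  · intro z hz
    simp only [Finset.coe_filter, Finset.mem_univ, true_and, Set.mem_ofPred_eq] at hz
    obtain ⟨i, hi⟩ := Finset.card_eq_one.mp hz
    refine ⟨i, by simp, ?_⟩
    funext j
    have hj := Finset.ext_iff.mp hi j
    simp only [Finset.mem_filter, Finset.mem_univ, true_and, Finset.mem_singleton] at hj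
    by_cases h : j = i
    · subst h
      have : x j ≠ z j := hj.mpr rfl
      simp only [Function.update_self]
      revert this
      cases x j <;> cases z j <;> simp
    · have : x j = z j := by
        by_contra hne
        exact h (hj.mp hne)
      simp [Function.update_of_ne h, this]

lemma cubeMass_flip_div {p : ℝ} (h0 : 0 < p) (h1 : p < 1) (x : ι → Bool) (i : ι) :
    cubeMass ι p (Function.update x i (!x i)) / cubeMass ι p x = bit p (!x i) / bit p (x i) := by
  have hx : cubeMass ι p x = bit p (x i) * ∏ j ∈ Finset.univ.erase i, bit p (x j) :=
    (Finset.mul_prod_erase _ _ (Finset.mem_univ i)).symm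
  have hy : cubeMass ι p (Function.update x i (!x i))
      = bit p (!x i) * ∏ j ∈ Finset.univ.erase i, bit p (x j) := by
    rw [cubeMass, ← Finset.mul_prod_erase _ _ (Finset.mem_univ i), Function.update_self]
    congr 1
    refine Finset.prod_congr rfl fun j hj => ?_
    rw [Function.update_of_ne (Finset.ne_of_mem_erase hj)]
  rw [hx, hy, mul_div_mul_right]
  exact (Finset.prod_pos fun j _ => bit_pos h0 h1 _).ne'

lemma min_one_bit_div {p : ℝ} (h0 : 0 < p) (h1 : p < 1) (b : Bool) :
    min 1 (bit p (!b) / bit p b) = bit p (!b) / max p (1 - p) := by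
  have h2 : 0 < 1 - p := by linarith
  rcases le_total p (1 - p) with h | h <;> cases b <;>
    simp only [bit, Bool.not_true, Bool.not_false, if_true, if_false, Bool.false_eq_true]
  · rw [max_eq_right h, min_eq_right ((div_le_one h2).mpr h)]
  · rw [max_eq_right h, min_eq_left ((one_le_div h0).mpr h), div_self h2.ne']
  · rw [max_eq_left h, min_eq_left ((one_le_div h2).mpr h), div_self h0.ne']
  · rw [max_eq_left h, min_eq_right ((div_le_one h0).mpr h)]

omit [Fintype ι] in
lemma resample_sub (p : ℝ) (i : ι) (f : (ι → Bool) → ℝ) (x : ι → Bool) :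
    resample p i f x - f x = bit p (!x i) * (f (Function.update x i (!x i)) - f x) := by
  have hs : Function.update x i (x i) = x := Function.update_eq_self i x
  have : f x = bit p (x i) * f x + bit p (!x i) * f x := by
    cases x i <;> simp [bit] <;> ring
  have h2 : resample p i f x
      = bit p (x i) * f x + bit p (!x i) * f (Function.update x i (!x i)) := by
    rw [resample, Fintype.sum_bool]
    conv_rhs => rw [← hs]
    cases x i <;> simp [add_comm]
  rw [h2]
  linear_combination -this

/-- One step of the lazy Metropolis chain for a Bernoulli product measure resamples each coordinate
with probability `resampleRate ι p`, and otherwise does nothing. -/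
lemma lazyMetropolis_mulVec {p : ℝ} (h0 : 0 < p) (h1 : p < 1) (f : (ι → Bool) → ℝ)
    (x : ι → Bool) :
    (lazyMetropolis (cubeMass ι p)).mulVec f x
      = f x + resampleRate ι p * ∑ i, (resample p i f x - f x) := by
  have hm : (metropolis (cubeMass ι p)).mulVec f x
      = f x + ∑ i, 1 / (Fintype.card ι : ℝ) * (bit p (!x i) / max p (1 - p))
          * (f (Function.update x i (!x i)) - f x) := by
    set c : (ι → Bool) → ℝ := fun z =>
      1 / (Fintype.card ι : ℝ) * min 1 (cubeMass ι p z / cubeMass ι p x) with hc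
    have h1' : ∀ y, metropolis (cubeMass ι p) x y * f y
        = (if hammingDist x y = 1 then c y * f y else 0)
          + if x = y then (1 - ∑ z : ι → Bool with hammingDist x z = 1, c z) * f y else 0 := by
      intro y
      by_cases hxy : x = y
      · subst hxy; simp [metropolis, hc]
      · simp only [metropolis, hxy, if_false, add_zero, hc]; split_ifs <;> simp
    rw [Matrix.mulVec, dotProduct, Finset.sum_congr rfl fun y _ => h1' y, Finset.sum_add_distrib,
      Finset.sum_ite_eq, if_pos (Finset.mem_univ x), ← Finset.sum_filter,
      sum_hammingDist_one, sum_hammingDist_one, sub_mul, one_mul, Finset.sum_mul]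
    rw [add_sub_left_comm, ← Finset.sum_sub_distrib]
    congr 1
    refine Finset.sum_congr rfl fun i _ => ?_
    rw [← mul_sub, hc]
    simp only [cubeMass_flip_div h0 h1, min_one_bit_div h0 h1]
  rw [lazyMetropolis, Matrix.smul_mulVec, Matrix.add_mulVec, Matrix.one_mulVec, Pi.smul_apply,
    Pi.add_apply, hm, smul_eq_mul, Finset.mul_sum, ← add_assoc, mul_add, ← two_mul,
    ← mul_assoc, Finset.mul_sum]
  norm_num only [one_div, inv_mul_cancel₀, one_mul]
  congr 1
  refine Finset.sum_congr rfl fun i _ => ?_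
  rw [resample_sub, resampleRate, mul_inv, mul_inv]
  ring

omit [DecidableEq ι] in
lemma resampleRate_nonneg {p : ℝ} (h0 : 0 < p) : 0 ≤ resampleRate ι p :=
  inv_nonneg.mpr (by have := max_pos h0; positivity)

omit [DecidableEq ι] in
lemma card_mul_resampleRate_le_one (p : ℝ) :
    (Fintype.card ι : ℝ) * resampleRate ι p ≤ 1 := by
  rcases Nat.eq_zero_or_pos (Fintype.card ι) with h | h
  · simp [h]
  · have h' : (0 : ℝ) < Fintype.card ι := by exact_mod_cast h
    have h2 := half_le_max p
    rw [resampleRate, ← div_eq_mul_inv, div_le_one (by nlinarith)]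
    nlinarith

omit [Fintype ι] in
lemma resample_nonneg {p : ℝ} (h0 : 0 < p) (h1 : p < 1) (i : ι) {f : (ι → Bool) → ℝ}
    (hf : ∀ x, 0 ≤ f x) (x : ι → Bool) : 0 ≤ resample p i f x :=
  Finset.sum_nonneg fun b _ => mul_nonneg (bit_pos h0 h1 b).le (hf _)

omit [Fintype ι] in
lemma resample_const (p : ℝ) (i : ι) (c : ℝ) (x : ι → Bool) :
    resample p i (fun _ => c) x = c := by
  rw [resample, ← Finset.sum_mul, sum_bit, one_mul]

lemma lazyMetropolis_mulVec_nonneg {p : ℝ} (h0 : 0 < p) (h1 : p < 1) {f : (ι → Bool) → ℝ}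
    (hf : ∀ x, 0 ≤ f x) (x : ι → Bool) :
    0 ≤ (lazyMetropolis (cubeMass ι p)).mulVec f x := by
  have e : f x + resampleRate ι p * ∑ i, (resample p i f x - f x)
      = (1 - Fintype.card ι * resampleRate ι p) * f x
        + resampleRate ι p * ∑ i, resample p i f x := by
    rw [Finset.sum_sub_distrib, Finset.sum_const, Finset.card_univ, nsmul_eq_mul]; ring
  rw [lazyMetropolis_mulVec h0 h1, e]
  have := card_mul_resampleRate_le_one (ι := ι) p
  exact add_nonneg (mul_nonneg (by linarith) (hf x)) (mul_nonneg (resampleRate_nonneg h0)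
    (Finset.sum_nonneg fun i _ => resample_nonneg h0 h1 i hf x))

lemma lazyMetropolis_nonneg {p : ℝ} (h0 : 0 < p) (h1 : p < 1) (x y : ι → Bool) :
    0 ≤ lazyMetropolis (cubeMass ι p) x y := by
  have h := lazyMetropolis_mulVec_nonneg h0 h1 (f := Pi.single y 1) (fun z => by
    by_cases hz : z = y
    · subst hz; simp
    · simp [hz]) x
  rwa [Matrix.mulVec_single_one] at h

lemma lazyMetropolis_row_sum {p : ℝ} (h0 : 0 < p) (h1 : p < 1) (x : ι → Bool) :
    ∑ y, lazyMetropolis (cubeMass ι p) x y = 1 := by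
  have h := lazyMetropolis_mulVec h0 h1 (fun _ => (1 : ℝ)) x
  simp only [resample_const, sub_self, Finset.sum_const_zero, mul_zero, add_zero] at h
  rw [← h]
  simp [Matrix.mulVec, dotProduct]

end BernoulliCube

/-! ### Distance to stationarity of a finite chain -/

namespace FiniteChain

variable {X : Type*} [Fintype X]

lemma le_tvDist (μ π : X → ℝ) (A : Finset X) : ∑ y ∈ A, μ y - ∑ y ∈ A, π y ≤ tvDist μ π :=
  le_ciSup (f := fun A : Finset X => ∑ y ∈ A, μ y - ∑ y ∈ A, π y) (Set.finite_range _).bddAbove A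

lemma tvDist_nonneg (μ π : X → ℝ) : 0 ≤ tvDist μ π := by
  simpa using le_tvDist μ π ∅

variable [DecidableEq X]

lemma tvDist_le_worstDist (P : Matrix X X ℝ) (π : X → ℝ) (t : ℕ) (x : X) :
    tvDist ((P ^ t) x) π ≤ worstDist P π t :=
  le_ciSup (f := fun x => tvDist ((P ^ t) x) π) (Set.finite_range _).bddAbove x

lemma worstDist_le [Nonempty X] {P : Matrix X X ℝ} {π : X → ℝ} {t : ℕ} {c : ℝ}
    (h : ∀ x, ∀ A : Finset X, ∑ y ∈ A, (P ^ t) x y - ∑ y ∈ A, π y ≤ c) :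
    worstDist P π t ≤ c :=
  ciSup_le fun x => ciSup_le fun A => h x A

lemma worstDist_nonneg [Nonempty X] (P : Matrix X X ℝ) (π : X → ℝ) (t : ℕ) :
    0 ≤ worstDist P π t :=
  (tvDist_nonneg _ _).trans (tvDist_le_worstDist P π t (Classical.arbitrary X))

lemma pow_nonneg_of_nonneg {P : Matrix X X ℝ} (h : ∀ x y, 0 ≤ P x y) (t : ℕ) (x y : X) :
    0 ≤ (P ^ t) x y := by
  induction t generalizing y with
  | zero => rw [pow_zero, Matrix.one_apply]; split_ifs <;> norm_num
  | succ t ih =>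
    rw [pow_succ, Matrix.mul_apply]
    exact Finset.sum_nonneg fun z _ => mul_nonneg (ih z) (h z y)

lemma pow_row_sum {P : Matrix X X ℝ} (h : ∀ x, ∑ y, P x y = 1) (t : ℕ) (x : X) :
    ∑ y, (P ^ t) x y = 1 := by
  induction t with
  | zero => simp [Matrix.one_apply]
  | succ t ih =>
    simp_rw [pow_succ, Matrix.mul_apply]
    rw [Finset.sum_comm]
    simp_rw [← Finset.mul_sum, h, mul_one, ih]

lemma worstDist_le_one [Nonempty X] {P : Matrix X X ℝ} {π : X → ℝ} (h : ∀ x y, 0 ≤ P x y)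
    (h' : ∀ x, ∑ y, P x y = 1) (hπ : ∀ x, 0 ≤ π x) (t : ℕ) : worstDist P π t ≤ 1 := by
  refine worstDist_le fun x A => ?_
  have h1 : ∑ y ∈ A, (P ^ t) x y ≤ 1 := by
    rw [← pow_row_sum h' t x]
    exact Finset.sum_le_sum_of_subset_of_nonneg (Finset.subset_univ A)
      fun y _ _ => pow_nonneg_of_nonneg h t x y
  have h2 : 0 ≤ ∑ y ∈ A, π y := Finset.sum_nonneg fun y _ => hπ y
  linarith

lemma worstDist_antitone [Nonempty X] {P : Matrix X X ℝ} (π : X → ℝ) (h : ∀ x y, 0 ≤ P x y)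
    (h' : ∀ x, ∑ y, P x y = 1) : Antitone (worstDist P π) := by
  refine antitone_nat_of_succ_le fun t => worstDist_le fun x A => ?_
  have e : ∑ y ∈ A, (P ^ (t + 1)) x y - ∑ y ∈ A, π y
      = ∑ z, P x z * (∑ y ∈ A, (P ^ t) z y - ∑ y ∈ A, π y) := by
    simp_rw [mul_sub, Finset.sum_sub_distrib]
    rw [← Finset.sum_mul, h', one_mul]
    simp_rw [pow_succ', Matrix.mul_apply, Finset.mul_sum]
    rw [Finset.sum_comm]
  rw [e]
  calc _ ≤ ∑ z, P x z * worstDist P π t := Finset.sum_le_sum fun z _ =>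
        mul_le_mul_of_nonneg_left
          ((le_tvDist _ _ A).trans (tvDist_le_worstDist P π t z)) (h x z)
    _ = worstDist P π t := by rw [← Finset.sum_mul, h', one_mul]

end FiniteChain

/-! ### Product characters -/

namespace BernoulliCube

variable {ι : Type*} [Fintype ι] [DecidableEq ι]

lemma sum_bit_mul_centred (p : ℝ) : ∑ b, bit p b * centred p b = 0 := by
  simp [bit, centred]; ring

omit [Fintype ι] in
lemma resample_walsh (p : ℝ) (S : Finset ι) (i : ι) (x : ι → Bool) :
    resample p i (walsh p S) x = if i ∈ S then 0 else walsh p S x := by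
  split_ifs with h
  · have e : ∀ b, walsh p S (Function.update x i b)
        = centred p b * ∏ j ∈ S.erase i, centred p (x j) := fun b => by
      rw [walsh, ← Finset.mul_prod_erase _ _ h, Function.update_self]
      congr 1
      refine Finset.prod_congr rfl fun j hj => ?_
      rw [Function.update_of_ne (Finset.ne_of_mem_erase hj)]
    simp_rw [resample, e, ← mul_assoc]
    rw [← Finset.sum_mul, sum_bit_mul_centred, zero_mul]
  · have e : ∀ b, walsh p S (Function.update x i b) = walsh p S x := fun b =>
      Finset.prod_congr rfl fun j hj => by
        rw [Function.update_of_ne (ne_of_mem_of_not_mem hj h)]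
    simp_rw [resample, e]
    rw [← Finset.sum_mul, sum_bit, one_mul]

lemma lazyMetropolis_mulVec_walsh {p : ℝ} (h0 : 0 < p) (h1 : p < 1) (S : Finset ι) :
    (lazyMetropolis (cubeMass ι p)).mulVec (walsh p S)
      = (1 - S.card * resampleRate ι p) • walsh p S := by
  funext x
  have e : ∀ i, resample p i (walsh p S) x - walsh p S x
      = if i ∈ S then -walsh p S x else 0 := fun i => by
    rw [resample_walsh]; split_ifs <;> ring
  rw [lazyMetropolis_mulVec h0 h1]
  simp_rw [e]
  rw [Finset.sum_ite_mem, Finset.univ_inter, Finset.sum_const, nsmul_eq_mul, Pi.smul_apply,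
    smul_eq_mul]
  ring

lemma pow_mulVec_walsh {p : ℝ} (h0 : 0 < p) (h1 : p < 1) (S : Finset ι) (t : ℕ) :
    (lazyMetropolis (cubeMass ι p) ^ t).mulVec (walsh p S)
      = (1 - S.card * resampleRate ι p) ^ t • walsh p S := by
  induction t with
  | zero => simp
  | succ t ih =>
    rw [pow_succ, ← Matrix.mulVec_mulVec, lazyMetropolis_mulVec_walsh h0 h1, Matrix.mulVec_smul,
      ih, smul_smul, pow_succ']

omit [DecidableEq ι] in
/-- Expansion of a point mass in product characters. -/
lemma single_eq_sum_walsh {p : ℝ} (h0 : 0 < p) (h1 : p < 1) (y : ι → Bool) :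
    (Pi.single y 1 : (ι → Bool) → ℝ)
      = ∑ S : Finset ι,
          (cubeMass ι p y * (walsh p S y / (p * (1 - p)) ^ S.card)) • walsh p S := by
  have h2 : 0 < 1 - p := by linarith
  funext x
  have e1 : ∀ i, bit p (y i) * (1 + centred p (x i) * centred p (y i) / (p * (1 - p)))
      = if x i = y i then 1 else 0 := fun i => by
    cases x i <;> cases y i <;>
      simp only [bit, centred, if_true, if_false, reduceCtorEq] <;> field_simp <;> ring
  have e2 : ∏ i, bit p (y i) * (1 + centred p (x i) * centred p (y i) / (p * (1 - p)))
      = (Pi.single y 1 : (ι → Bool) → ℝ) x := by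
    simp_rw [e1]
    by_cases h : x = y
    · subst h; simp
    · obtain ⟨i, hi⟩ := Function.ne_iff.mp h
      rw [Pi.single_eq_of_ne h]
      exact Finset.prod_eq_zero (Finset.mem_univ i) (if_neg hi)
  rw [← e2, Finset.prod_mul_distrib, Finset.prod_one_add, Finset.sum_apply, Finset.powerset_univ,
    Finset.mul_sum]
  refine Finset.sum_congr rfl fun S _ => ?_
  rw [Finset.prod_div_distrib, Finset.prod_mul_distrib, Finset.prod_const, Pi.smul_apply,
    smul_eq_mul, walsh, walsh, cubeMass]
  ring

/-- The spectral expansion of the `t`-step transition probabilities. -/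
lemma pow_apply {p : ℝ} (h0 : 0 < p) (h1 : p < 1) (t : ℕ) (x y : ι → Bool) :
    (lazyMetropolis (cubeMass ι p) ^ t) x y
      = cubeMass ι p y * ∑ S : Finset ι, (1 - S.card * resampleRate ι p) ^ t
          * (walsh p S x * walsh p S y / (p * (1 - p)) ^ S.card) := by
  have h : (lazyMetropolis (cubeMass ι p) ^ t) x y
      = ((lazyMetropolis (cubeMass ι p) ^ t).mulVec (Pi.single y 1)) x := by
    rw [Matrix.mulVec_single_one]; rfl
  rw [h, single_eq_sum_walsh h0 h1, Matrix.mulVec_sum, Finset.sum_apply, Finset.mul_sum]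
  refine Finset.sum_congr rfl fun S _ => ?_
  rw [Matrix.mulVec_smul, pow_mulVec_walsh h0 h1]
  simp only [Pi.smul_apply, smul_eq_mul]
  ring

lemma pow_reversible {p : ℝ} (h0 : 0 < p) (h1 : p < 1) (t : ℕ) (x y : ι → Bool) :
    cubeMass ι p x * (lazyMetropolis (cubeMass ι p) ^ t) x y
      = cubeMass ι p y * (lazyMetropolis (cubeMass ι p) ^ t) y x := by
  rw [pow_apply h0 h1, pow_apply h0 h1]
  simp_rw [mul_comm (walsh p _ x)]
  ring

lemma pow_stationary {p : ℝ} (h0 : 0 < p) (h1 : p < 1) (t : ℕ) (y : ι → Bool) :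
    ∑ x, cubeMass ι p x * (lazyMetropolis (cubeMass ι p) ^ t) x y = cubeMass ι p y := by
  simp_rw [pow_reversible h0 h1 t _ y]
  rw [← Finset.mul_sum, FiniteChain.pow_row_sum (lazyMetropolis_row_sum h0 h1), mul_one]

/-! ### The upper bound in mean square -/

lemma centred_sq_div_le {p : ℝ} (h0 : 0 < p) (h1 : p < 1) (b : Bool) :
    centred p b ^ 2 / (p * (1 - p)) ≤ max p (1 - p) / (1 - max p (1 - p)) := by
  have h2 : 0 < 1 - p := by linarith
  rcases le_total p (1 - p) with h | h
  · rw [max_eq_right h, sub_sub_cancel, div_le_div_iff₀ (by positivity) h0]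
    cases b <;> simp only [centred, if_true, if_false, Bool.false_eq_true]
    · have : p ^ 2 ≤ (1 - p) ^ 2 := by gcongr
      nlinarith
    · nlinarith
  · rw [max_eq_left h, div_le_div_iff₀ (by positivity) h2]
    cases b <;> simp only [centred, if_true, if_false, Bool.false_eq_true]
    · nlinarith
    · have : (1 - p) ^ 2 ≤ p ^ 2 := by gcongr
      nlinarith

/-- The normalized return probability, which is the squared `L²` norm of the density of the chain
at half the time. -/
lemma return_prob_div_le {p : ℝ} (h0 : 0 < p) (h1 : p < 1) (t : ℕ) (x : ι → Bool) :
    (lazyMetropolis (cubeMass ι p) ^ t) x x / cubeMass ι p x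
      ≤ Real.exp (Fintype.card ι * (max p (1 - p) / (1 - max p (1 - p)))
          * Real.exp (-(t * resampleRate ι p))) := by
  set u := resampleRate ι p with hu
  set r := max p (1 - p) / (1 - max p (1 - p)) with hr
  have hv : 0 < p * (1 - p) := mul_pos h0 (by linarith)
  have hu0 : 0 ≤ u := resampleRate_nonneg h0
  have hr0 : 0 ≤ r := le_trans (by positivity) (centred_sq_div_le h0 h1 true)
  rw [pow_apply h0 h1, mul_div_cancel_left₀ _ (cubeMass_pos h0 h1 x).ne']
  calc _ ≤ ∑ S : Finset ι, ∏ _i ∈ S, (r * Real.exp (-(t * u))) := by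
        refine Finset.sum_le_sum fun S _ => ?_
        have e : walsh p S x * walsh p S x / (p * (1 - p)) ^ S.card
            = ∏ i ∈ S, centred p (x i) ^ 2 / (p * (1 - p)) := by
          rw [Finset.prod_div_distrib, Finset.prod_const, Finset.prod_pow, walsh, sq]
        have k0 : 0 ≤ 1 - S.card * u := by
          have : (S.card : ℝ) ≤ Fintype.card ι := by exact_mod_cast Finset.card_le_univ S
          have := card_mul_resampleRate_le_one (ι := ι) p
          nlinarith
        have k1 : (1 - S.card * u) ^ t ≤ ∏ _i ∈ S, Real.exp (-(t * u)) := by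
          have : 1 - S.card * u ≤ Real.exp (-(S.card * u)) := by
            have := Real.add_one_le_exp (-(S.card * u)); linarith
          refine (pow_le_pow_left₀ k0 this t).trans_eq ?_
          rw [Finset.prod_const, ← Real.exp_nat_mul, ← Real.exp_nat_mul]
          congr 1; ring
        rw [e, mul_comm, Finset.prod_mul_distrib]
        refine mul_le_mul (Finset.prod_le_prod (fun i _ => by positivity)
          fun i _ => centred_sq_div_le h0 h1 _) k1 (pow_nonneg k0 t) ?_
        exact Finset.prod_nonneg fun _ _ => hr0
    _ = (1 + r * Real.exp (-(t * u))) ^ Fintype.card ι := by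
        rw [← Finset.powerset_univ, ← Finset.prod_one_add, Finset.prod_const, Finset.card_univ]
    _ ≤ Real.exp (r * Real.exp (-(t * u))) ^ Fintype.card ι := by
        refine pow_le_pow_left₀ (by positivity) ?_ _
        linarith [Real.add_one_le_exp (r * Real.exp (-(t * u)))]
    _ = _ := by rw [← Real.exp_nat_mul, mul_assoc]

lemma sum_sq_div {p : ℝ} (h0 : 0 < p) (h1 : p < 1) (t : ℕ) (x : ι → Bool) :
    ∑ y, (lazyMetropolis (cubeMass ι p) ^ t) x y ^ 2 / cubeMass ι p y
      = (lazyMetropolis (cubeMass ι p) ^ (2 * t)) x x / cubeMass ι p x := by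
  rw [two_mul, pow_add, Matrix.mul_apply, Finset.sum_div]
  refine Finset.sum_congr rfl fun y _ => ?_
  rw [div_eq_div_iff (cubeMass_pos h0 h1 y).ne' (cubeMass_pos h0 h1 x).ne']
  linear_combination (lazyMetropolis (cubeMass ι p) ^ t) x y * pow_reversible h0 h1 t x y

lemma worstDist_le_sqrt {p : ℝ} (h0 : 0 < p) (h1 : p < 1) (t : ℕ) :
    worstDist (lazyMetropolis (cubeMass ι p)) (cubeMass ι p) t
      ≤ √(Real.exp (Fintype.card ι * (max p (1 - p) / (1 - max p (1 - p)))
          * Real.exp (-(2 * t * resampleRate ι p))) - 1) := by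
  refine FiniteChain.worstDist_le fun x A => Real.le_sqrt_of_sq_le ?_
  set P := lazyMetropolis (cubeMass ι p) with hP
  have hπ := cubeMass_pos (ι := ι) h0 h1
  have key := return_prob_div_le h0 h1 (2 * t) x
  rw [← sum_sq_div h0 h1] at key
  push_cast at key
  have nn : ∀ y, 0 ≤ ((P ^ t) x y - cubeMass ι p y) ^ 2 / cubeMass ι p y := fun y =>
    div_nonneg (sq_nonneg _) (hπ y).le
  have e : ∑ y, ((P ^ t) x y - cubeMass ι p y) ^ 2 / cubeMass ι p y
      = ∑ y, (P ^ t) x y ^ 2 / cubeMass ι p y - 1 := by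
    have : ∀ y, ((P ^ t) x y - cubeMass ι p y) ^ 2 / cubeMass ι p y
        = (P ^ t) x y ^ 2 / cubeMass ι p y - 2 * (P ^ t) x y + cubeMass ι p y := fun y => by
      have := (hπ y).ne'
      field_simp
      ring
    simp_rw [this]
    rw [Finset.sum_add_distrib, Finset.sum_sub_distrib, ← Finset.mul_sum,
      FiniteChain.pow_row_sum (lazyMetropolis_row_sum h0 h1), sum_cubeMass]
    ring
  calc _ = (∑ y ∈ A, ((P ^ t) x y - cubeMass ι p y)) ^ 2 := by rw [Finset.sum_sub_distrib]
    _ ≤ (∑ y ∈ A, cubeMass ι p y)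
          * ∑ y ∈ A, ((P ^ t) x y - cubeMass ι p y) ^ 2 / cubeMass ι p y :=
        Finset.sum_sq_le_sum_mul_sum_of_sq_le_mul A (fun y _ => (hπ y).le) (fun y _ => nn y)
          fun y _ => by rw [mul_div_cancel₀ _ (hπ y).ne']
    _ ≤ 1 * ∑ y, ((P ^ t) x y - cubeMass ι p y) ^ 2 / cubeMass ι p y := by
        refine mul_le_mul ?_ ?_ (Finset.sum_nonneg fun y _ => nn y) zero_le_one
        · rw [← sum_cubeMass (ι := ι) p]
          exact Finset.sum_le_sum_of_subset_of_nonneg (Finset.subset_univ A)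
            fun y _ _ => (hπ y).le
        · exact Finset.sum_le_sum_of_subset_of_nonneg (Finset.subset_univ A) fun y _ _ => nn y
    _ ≤ _ := by rw [one_mul, e]; linarith

/-! ### The upper bound by contraction -/

/-- Changing one coordinate of the argument increases `f` by at most `c`. -/
def OscLE (f : (ι → Bool) → ℝ) (c : ℝ) : Prop :=
  ∀ x i b, f (Function.update x i b) - f x ≤ c

/-- One step of the chain contracts oscillations: resampling coordinate `i` forgets its value, and
resampling another coordinate does no harm. -/
lemma OscLE.lazyMetropolis_mulVec {p : ℝ} (h0 : 0 < p) (h1 : p < 1) {f : (ι → Bool) → ℝ} {c : ℝ}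
    (h : OscLE f c) :
    OscLE ((lazyMetropolis (cubeMass ι p)).mulVec f) ((1 - resampleRate ι p) * c) := by
  intro x i b
  set y := Function.update x i b with hy
  set u := resampleRate ι p with hu
  have hu0 : 0 ≤ u := resampleRate_nonneg h0
  have hN : Fintype.card ι * u ≤ 1 := card_mul_resampleRate_le_one p
  have hs : ∑ j, (resample p j f y - resample p j f x) ≤ ((Fintype.card ι : ℝ) - 1) * c := by
    have hi : resample p i f y = resample p i f x := by simp [resample, hy]
    have hj : ∀ j ∈ Finset.univ.erase i, resample p j f y - resample p j f x ≤ c := by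
      intro j hj
      have hji := Finset.ne_of_mem_erase hj
      calc resample p j f y - resample p j f x
          = ∑ b', bit p b' * (f (Function.update (Function.update x j b') i b)
              - f (Function.update x j b')) := by
            rw [resample, resample, ← Finset.sum_sub_distrib]
            refine Finset.sum_congr rfl fun b' _ => ?_
            rw [hy, Function.update_comm hji, mul_sub]
        _ ≤ ∑ b', bit p b' * c := Finset.sum_le_sum fun b' _ =>
            mul_le_mul_of_nonneg_left (h _ _ _) (bit_pos h0 h1 b').le
        _ = c := by rw [← Finset.sum_mul, sum_bit, one_mul]
    rw [← Finset.add_sum_erase _ _ (Finset.mem_univ i), hi, sub_self, zero_add]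
    refine (Finset.sum_le_card_nsmul _ _ _ hj).trans_eq ?_
    rw [Finset.card_erase_of_mem (Finset.mem_univ i), Finset.card_univ, nsmul_eq_mul,
      Nat.cast_sub (Fintype.card_pos_iff.mpr ⟨i⟩), Nat.cast_one]
  have e : (lazyMetropolis (cubeMass ι p)).mulVec f y - (lazyMetropolis (cubeMass ι p)).mulVec f x
      = (1 - Fintype.card ι * u) * (f y - f x)
        + u * ∑ j, (resample p j f y - resample p j f x) := by
    rw [BernoulliCube.lazyMetropolis_mulVec h0 h1, BernoulliCube.lazyMetropolis_mulVec h0 h1]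
    simp_rw [Finset.sum_sub_distrib, Finset.sum_const, Finset.card_univ, nsmul_eq_mul]
    ring
  rw [e]
  have a1 := mul_le_mul_of_nonneg_left (h x i b) (sub_nonneg.mpr hN)
  have a2 := mul_le_mul_of_nonneg_left hs hu0
  linarith

lemma OscLE.pow_mulVec {p : ℝ} (h0 : 0 < p) (h1 : p < 1) {f : (ι → Bool) → ℝ} {c : ℝ}
    (h : OscLE f c) (t : ℕ) :
    OscLE ((lazyMetropolis (cubeMass ι p) ^ t).mulVec f) ((1 - resampleRate ι p) ^ t * c) := by
  induction t with
  | zero => simpa using h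
  | succ t ih =>
    have := OscLE.lazyMetropolis_mulVec h0 h1 ih
    rwa [Matrix.mulVec_mulVec, ← pow_succ', ← mul_assoc, ← pow_succ'] at this

lemma OscLE.sub_le {f : (ι → Bool) → ℝ} {c : ℝ} (h : OscLE f c) (x y : ι → Bool) :
    f y - f x ≤ Fintype.card ι * c := by
  have key : ∀ s : Finset ι, f (s.piecewise y x) - f x ≤ s.card * c := by
    intro s
    induction s using Finset.induction_on with
    | empty => simp
    | insert j s hj ih =>
      rw [Finset.piecewise_insert, Finset.card_insert_of_notMem hj]
      have := h (s.piecewise y x) j (y j)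
      push_cast
      linarith
  simpa using key Finset.univ

lemma worstDist_le_card_mul_pow {p : ℝ} (h0 : 0 < p) (h1 : p < 1) (t : ℕ) :
    worstDist (lazyMetropolis (cubeMass ι p)) (cubeMass ι p) t
      ≤ Fintype.card ι * (1 - resampleRate ι p) ^ t := by
  refine FiniteChain.worstDist_le fun x A => ?_
  set P := lazyMetropolis (cubeMass ι p) with hP
  set f : (ι → Bool) → ℝ := fun y => if y ∈ A then 1 else 0 with hf
  have hosc : OscLE f 1 := fun x i b => by
    simp only [hf]; split_ifs <;> norm_num
  have e1 : ∀ z, ((P ^ t).mulVec f) z = ∑ y ∈ A, (P ^ t) z y := fun z => by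
    simp [Matrix.mulVec, dotProduct, hf]
  have e2 : ∑ y ∈ A, cubeMass ι p y = ∑ z, cubeMass ι p z * ((P ^ t).mulVec f) z := by
    simp_rw [e1, Finset.mul_sum]
    rw [Finset.sum_comm]
    exact Finset.sum_congr rfl fun y _ => (pow_stationary h0 h1 t y).symm
  rw [← e1, e2]
  calc _ = ∑ z, cubeMass ι p z * (((P ^ t).mulVec f) x - ((P ^ t).mulVec f) z) := by
        simp_rw [mul_sub, Finset.sum_sub_distrib, ← Finset.sum_mul, sum_cubeMass, one_mul]
    _ ≤ ∑ z, cubeMass ι p z * (Fintype.card ι * ((1 - resampleRate ι p) ^ t * 1)) :=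
        Finset.sum_le_sum fun z _ => mul_le_mul_of_nonneg_left
          ((hosc.pow_mulVec h0 h1 t).sub_le z x) (cubeMass_pos h0 h1 z).le
    _ = _ := by rw [← Finset.sum_mul, sum_cubeMass, one_mul, mul_one]

/-! ### The lower bound by the second moment method -/

/-- If a statistic `h` has second moment at most `W` about `M` under `μ`, and at most `V` about zero
under `π`, then the event `|M| / 2 < |h|` distinguishes `μ` from `π`, by Chebyshev. -/
lemma one_sub_le_tvDist {X : Type*} [Fintype X] {μ π : X → ℝ} (hμ : ∀ x, 0 ≤ μ x)
    (hπ : ∀ x, 0 ≤ π x) (hμ1 : ∑ x, μ x = 1) (h : X → ℝ) {M V W : ℝ} (hM : M ≠ 0)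
    (hV : ∑ x, π x * h x ^ 2 ≤ V) (hW : ∑ x, μ x * (h x - M) ^ 2 ≤ W) :
    1 - 4 * (V + W) / M ^ 2 ≤ tvDist μ π := by
  classical
  have hM2 : 0 < M ^ 2 := by positivity
  set A : Finset X := Finset.univ.filter fun x => |M| / 2 < |h x| with hA
  have a1 : ∑ x ∈ A, π x ≤ 4 * V / M ^ 2 := by
    rw [le_div_iff₀ hM2, Finset.sum_mul]
    calc ∑ x ∈ A, π x * M ^ 2 ≤ ∑ x ∈ A, 4 * (π x * h x ^ 2) := by
          refine Finset.sum_le_sum fun x hx => ?_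
          have hx : |M| / 2 < |h x| := (Finset.mem_filter.mp hx).2
          have : M ^ 2 ≤ 4 * h x ^ 2 := by
            rw [← sq_abs M, ← sq_abs (h x)]; nlinarith [abs_nonneg M]
          nlinarith [hπ x]
      _ ≤ ∑ x, 4 * (π x * h x ^ 2) := Finset.sum_le_sum_of_subset_of_nonneg
          (Finset.subset_univ A) fun x _ _ => by have := hπ x; positivity
      _ ≤ 4 * V := by rw [← Finset.mul_sum]; linarith
  have a2 : ∑ x ∈ Aᶜ, μ x ≤ 4 * W / M ^ 2 := by
    rw [le_div_iff₀ hM2, Finset.sum_mul]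
    calc ∑ x ∈ Aᶜ, μ x * M ^ 2 ≤ ∑ x ∈ Aᶜ, 4 * (μ x * (h x - M) ^ 2) := by
          refine Finset.sum_le_sum fun x hx => ?_
          have hx : |h x| ≤ |M| / 2 := by
            by_contra hlt
            exact Finset.mem_compl.mp hx (Finset.mem_filter.mpr ⟨Finset.mem_univ x, not_le.mp hlt⟩)
          have h1 : |M| / 2 ≤ |h x - M| := by
            have := abs_sub_abs_le_abs_sub M (h x)
            rw [abs_sub_comm] at this
            linarith
          have : M ^ 2 ≤ 4 * (h x - M) ^ 2 := by
            rw [← sq_abs M, ← sq_abs (h x - M)]; nlinarith [abs_nonneg M]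
          nlinarith [hμ x]
      _ ≤ ∑ x, 4 * (μ x * (h x - M) ^ 2) := Finset.sum_le_sum_of_subset_of_nonneg
          (Finset.subset_univ _) fun x _ _ => by have := hμ x; positivity
      _ ≤ 4 * W := by rw [← Finset.mul_sum]; linarith
  have a3 : ∑ x ∈ A, μ x + ∑ x ∈ Aᶜ, μ x = 1 := by rw [Finset.sum_add_sum_compl, hμ1]
  refine le_trans ?_ (FiniteChain.le_tvDist μ π A)
  rw [mul_add, add_div]
  linarith

lemma sum_cubeMass_mul_walsh (p : ℝ) {S : Finset ι} (hS : S.Nonempty) :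
    ∑ x, cubeMass ι p x * walsh p S x = 0 := by
  have e : ∀ x : ι → Bool, cubeMass ι p x * walsh p S x
      = ∏ i, (bit p (x i) * if i ∈ S then centred p (x i) else 1) := fun x => by
    rw [Finset.prod_mul_distrib, Finset.prod_ite_mem, Finset.univ_inter]; rfl
  simp_rw [e]
  rw [sum_prod_eq fun i b => bit p b * if i ∈ S then centred p b else 1]
  obtain ⟨i, hi⟩ := hS
  refine Finset.prod_eq_zero (Finset.mem_univ i) ?_
  simp only [hi, if_true, sum_bit_mul_centred]

omit [DecidableEq ι] in
lemma sum_centred_eq (p : ℝ) (x : ι → Bool) :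
    ∑ i, centred p (x i) = ∑ i, walsh p {i} x := by simp [walsh]

/-- The square of the centred sum, in terms of product characters. -/
lemma sum_centred_sq (p : ℝ) (x : ι → Bool) :
    (∑ i, centred p (x i)) ^ 2
      = Fintype.card ι * (p * (1 - p)) + (1 - 2 * p) * ∑ i, walsh p {i} x
        + ∑ q ∈ (Finset.univ : Finset ι).offDiag, walsh p {q.1, q.2} x := by
  have e1 : ∀ b, centred p b * centred p b = p * (1 - p) + (1 - 2 * p) * centred p b := fun b => by
    cases b <;> simp [centred] <;> ring
  have e2 : ∑ q ∈ (Finset.univ : Finset ι).offDiag, walsh p {q.1, q.2} x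
      = ∑ q ∈ (Finset.univ : Finset ι).offDiag, centred p (x q.1) * centred p (x q.2) :=
    Finset.sum_congr rfl fun q hq => by
      rw [walsh, Finset.prod_pair (Finset.mem_offDiag.mp hq).2.2]
  rw [sq, Finset.sum_mul_sum, ← Finset.sum_product', ← Finset.diag_union_offDiag,
    Finset.sum_union (Finset.disjoint_diag_offDiag _), e2, Finset.sum_diag, ← sum_centred_eq]
  simp_rw [e1]
  rw [Finset.sum_add_distrib, Finset.sum_const, Finset.card_univ, nsmul_eq_mul, Finset.mul_sum]

/-- The second moment of the centred sum, under a distribution for which the product characters of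
one and of two coordinates have constant means `a` and `b`. -/
lemma sum_mul_sum_centred_sq (p : ℝ) {μ : (ι → Bool) → ℝ} (hμ : ∑ x, μ x = 1) {a b : ℝ}
    (ha : ∀ i, ∑ x, μ x * walsh p {i} x = a)
    (hb : ∀ i j, i ≠ j → ∑ x, μ x * walsh p {i, j} x = b) :
    ∑ x, μ x * (∑ i, centred p (x i)) ^ 2
      = Fintype.card ι * (p * (1 - p)) + (1 - 2 * p) * (Fintype.card ι * a)
        + ((Fintype.card ι : ℝ) ^ 2 - Fintype.card ι) * b := by
  simp_rw [sum_centred_sq, mul_add, Finset.sum_add_distrib, ← Finset.sum_mul, hμ, one_mul,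
    mul_left_comm _ (1 - 2 * p), ← Finset.mul_sum]
  congr 1
  · congr 2
    simp_rw [Finset.mul_sum]
    rw [Finset.sum_comm]
    simp_rw [ha]
    simp
  · simp_rw [Finset.mul_sum]
    rw [Finset.sum_comm, Finset.sum_congr rfl fun q hq => hb q.1 q.2 (Finset.mem_offDiag.mp hq).2.2,
      Finset.sum_const, Finset.offDiag_card, nsmul_eq_mul, Finset.card_univ,
      Nat.cast_sub (Nat.le_mul_self _)]
    push_cast
    ring

/-- After `t` steps from the stationarily least likely state, the sum of the centred coordinates has
mean `± M`, and variance at most its stationary variance plus `M`; apply Chebyshev's inequality. -/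
lemma one_sub_le_worstDist {p : ℝ} (h0 : 0 < p) (h1 : p < 1) (hN : 2 ≤ Fintype.card ι) (t : ℕ)
    {M : ℝ} (hM : M = Fintype.card ι * max p (1 - p) * (1 - resampleRate ι p) ^ t) (hM0 : 0 < M) :
    1 - 4 * (2 * (Fintype.card ι * (p * (1 - p))) + M) / M ^ 2
      ≤ worstDist (lazyMetropolis (cubeMass ι p)) (cubeMass ι p) t := by
  set P := lazyMetropolis (cubeMass ι p) with hP
  set N : ℝ := (Fintype.card ι : ℝ) with hNdef
  set u := resampleRate ι p with hu
  have hN2 : (2 : ℝ) ≤ N := by rw [hNdef]; exact_mod_cast hN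
  have hu0 : 0 ≤ u := resampleRate_nonneg h0
  have hNu : N * u ≤ 1 := card_mul_resampleRate_le_one p
  obtain ⟨a, ha⟩ : ∃ a, |centred p a| = max p (1 - p) := by
    rcases le_total p (1 - p) with h | h
    · exact ⟨true, by simp [centred, max_eq_right h, abs_of_pos (sub_pos.mpr h1)]⟩
    · exact ⟨false, by simp [centred, max_eq_left h, abs_of_pos h0]⟩
  set x₀ : ι → Bool := fun _ => a with hx₀
  set g := centred p a with hg
  set m := N * ((1 - u) ^ t * g) with hm
  have hu1 : 0 ≤ 1 - u := by nlinarith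
  have habs : |m| = M := by
    rw [hm, abs_mul, abs_mul, ha, abs_of_nonneg (pow_nonneg hu1 t),
      abs_of_nonneg (by linarith : (0 : ℝ) ≤ N), hM]
    ring
  have hsq : m ^ 2 = M ^ 2 := by rw [← habs, sq_abs]
  have hm0 : m ≠ 0 := by rw [← abs_pos, habs]; exact hM0
  have hw : ∀ S, ∑ x, (P ^ t) x₀ x * walsh p S x = (1 - S.card * u) ^ t * g ^ S.card := by
    intro S
    have := congrFun (pow_mulVec_walsh h0 h1 S t) x₀
    rw [Pi.smul_apply, smul_eq_mul] at this
    rw [hP, hu, ← Finset.prod_const]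
    exact this
  have hμ1 := FiniteChain.pow_row_sum (lazyMetropolis_row_sum (ι := ι) h0 h1) t x₀
  have hwi : ∀ i, ∑ x, (P ^ t) x₀ x * walsh p {i} x = (1 - u) ^ t * g := fun i => by
    rw [hw]; simp
  have hmean : ∑ x, (P ^ t) x₀ x * ∑ i, centred p (x i) = m := by
    simp_rw [sum_centred_eq, Finset.mul_sum]
    rw [Finset.sum_comm]
    simp_rw [hwi]
    rw [Finset.sum_const, Finset.card_univ, nsmul_eq_mul]
  have hsecond := sum_mul_sum_centred_sq p hμ1 hwi (b := (1 - 2 * u) ^ t * g ^ 2)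
    fun i j hij => by rw [hw, Finset.card_pair hij]; norm_num
  have hV : ∑ x, cubeMass ι p x * (∑ i, centred p (x i)) ^ 2 ≤ N * (p * (1 - p)) := by
    rw [sum_mul_sum_centred_sq p (sum_cubeMass p)
      (fun i => sum_cubeMass_mul_walsh p (Finset.singleton_nonempty i))
      (fun i j _ => sum_cubeMass_mul_walsh p (Finset.insert_nonempty i {j}))]
    simp [hNdef]
  have hW : ∑ x, (P ^ t) x₀ x * (∑ i, centred p (x i) - m) ^ 2 ≤ N * (p * (1 - p)) + M := by
    have e : ∀ x, (P ^ t) x₀ x * (∑ i, centred p (x i) - m) ^ 2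
        = (P ^ t) x₀ x * (∑ i, centred p (x i)) ^ 2
          - 2 * m * ((P ^ t) x₀ x * ∑ i, centred p (x i)) + m ^ 2 * (P ^ t) x₀ x := fun x => by
      ring
    have hlam : (1 - 2 * u) ^ t ≤ ((1 - u) ^ t) ^ 2 := by
      rw [← pow_mul, mul_comm t 2, pow_mul]
      exact pow_le_pow_left₀ (by nlinarith) (by nlinarith) t
    have hcov : (N ^ 2 - N) * ((1 - 2 * u) ^ t * g ^ 2) ≤ m ^ 2 := by
      have hb : 0 ≤ (1 - 2 * u) ^ t := pow_nonneg (by nlinarith) t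
      calc _ ≤ N ^ 2 * ((1 - 2 * u) ^ t * g ^ 2) := by
            have : 0 ≤ (1 - 2 * u) ^ t * g ^ 2 := by positivity
            nlinarith
        _ ≤ N ^ 2 * (((1 - u) ^ t) ^ 2 * g ^ 2) := by gcongr
        _ = m ^ 2 := by rw [hm]; ring
    have hlin : (1 - 2 * p) * m ≤ M := by
      rw [← habs]
      refine (le_abs_self _).trans ?_
      rw [abs_mul]
      exact mul_le_of_le_one_left (abs_nonneg m) (abs_le.mpr ⟨by linarith, by linarith⟩)
    simp_rw [e]
    rw [Finset.sum_add_distrib, Finset.sum_sub_distrib, ← Finset.mul_sum, ← Finset.mul_sum, hmean,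
      hμ1, hsecond, ← hNdef, ← hm]
    nlinarith
  have key := one_sub_le_tvDist
    (FiniteChain.pow_nonneg_of_nonneg (lazyMetropolis_nonneg h0 h1) t x₀)
    (fun x => (cubeMass_pos h0 h1 x).le) hμ1 _ hm0 hV hW
  refine le_trans (le_of_eq ?_) (key.trans (FiniteChain.tvDist_le_worstDist _ _ t x₀))
  rw [hsq]
  ring

end BernoulliCube

/-! ### Cutoff from two-sided bounds -/

/-- Up to any `ε`, the distances `d ν` are one at times `T ν - α w ν` and zero at times
`T ν + α w ν`, once `α` is large and, depending on `α`, so is `ν`. -/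
def SharpTransition (d : ℕ → ℕ → ℝ) (T w : ℕ → ℝ) : Prop :=
  ∀ ε : ℝ, 0 < ε → ∃ α₀ : ℝ, ∀ α, α₀ ≤ α → ∀ᶠ ν in atTop,
    1 - ε ≤ d ν ⌊T ν - α * w ν⌋₊ ∧ d ν ⌊T ν + α * w ν⌋₊ ≤ ε

namespace SharpTransition

variable {d : ℕ → ℕ → ℝ} {T w : ℕ → ℝ}

lemma dropsAt (h : SharpTransition d T w) (hw : w =o[atTop] T)
    (hd : ∀ᶠ ν in atTop, ∀ t, 0 ≤ d ν t ∧ d ν t ≤ 1) : DropsAt d T w := by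
  have hbd : ∀ s : ℕ → ℕ, IsBoundedUnder (· ≤ ·) atTop (fun ν => d ν (s ν)) ∧
      IsBoundedUnder (· ≥ ·) atTop (fun ν => d ν (s ν)) := fun s =>
    ⟨isBoundedUnder_of_eventually_le (hd.mono fun ν hν => (hν _).2),
      isBoundedUnder_of_eventually_ge (hd.mono fun ν hν => (hν _).1)⟩
  refine ⟨hw, ?_, ?_⟩
  · rw [Metric.tendsto_atTop]
    intro ε hε
    obtain ⟨α₀, h₀⟩ := h (ε / 2) (by positivity)
    refine ⟨α₀, fun α hα => ?_⟩
    obtain ⟨b1, b2⟩ := hbd fun ν => ⌊T ν - α * w ν⌋₊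
    have h1 : 1 - ε / 2 ≤ liminf (fun ν => d ν ⌊T ν - α * w ν⌋₊) atTop :=
      le_liminf_of_le b1.isCoboundedUnder_ge ((h₀ α hα).mono fun ν hν => hν.1)
    have h2 : liminf (fun ν => d ν ⌊T ν - α * w ν⌋₊) atTop ≤ 1 :=
      (liminf_le_limsup b1 b2).trans
        (limsup_le_of_le b2.isCoboundedUnder_le (hd.mono fun ν hν => (hν _).2))
    rw [Real.dist_eq, abs_lt]
    constructor <;> linarith
  · rw [Metric.tendsto_atTop]
    intro ε hε
    obtain ⟨α₀, h₀⟩ := h (ε / 2) (by positivity)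
    refine ⟨α₀, fun α hα => ?_⟩
    obtain ⟨b1, b2⟩ := hbd fun ν => ⌊T ν + α * w ν⌋₊
    have h1 : limsup (fun ν => d ν ⌊T ν + α * w ν⌋₊) atTop ≤ ε / 2 :=
      limsup_le_of_le b2.isCoboundedUnder_le ((h₀ α hα).mono fun ν hν => hν.2)
    have h2 : 0 ≤ limsup (fun ν => d ν ⌊T ν + α * w ν⌋₊) atTop :=
      (le_liminf_of_le b1.isCoboundedUnder_ge (hd.mono fun ν hν => (hν _).1)).trans
        (liminf_le_limsup b1 b2)
    rw [Real.dist_eq, abs_lt]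
    constructor <;> linarith

/-- All mixing times lie within a constant number of windows from the centre. -/
lemma abs_mixingTime_sub_le (h : SharpTransition d T w) (hT : ∀ᶠ ν in atTop, 0 ≤ T ν)
    (hw : ∀ᶠ ν in atTop, 0 ≤ w ν) (hanti : ∀ᶠ ν in atTop, Antitone (d ν))
    {ε : ℝ} (h0 : 0 < ε) (h1 : ε < 1) :
    ∃ C : ℝ, ∀ᶠ ν in atTop, |(mixingTime (d ν) ε : ℝ) - T ν| ≤ C * w ν := by
  obtain ⟨α₁, h₁⟩ := h ε h0
  obtain ⟨α₂, h₂⟩ := h ((1 - ε) / 2) (by linarith)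
  set α := max 0 (max α₁ α₂)
  have hα0 : 0 ≤ α := le_max_left _ _
  refine ⟨α, ?_⟩
  filter_upwards [h₁ α ((le_max_left _ _).trans (le_max_right _ _)),
    h₂ α ((le_max_right _ _).trans (le_max_right _ _)), hT, hw, hanti] with ν k₁ k₂ kT kw ka
  have hmem : ⌊T ν + α * w ν⌋₊ ∈ {t : ℕ | d ν t ≤ ε} := k₁.2
  have hup : mixingTime (d ν) ε ≤ ⌊T ν + α * w ν⌋₊ := Nat.sInf_le hmem
  have hin : d ν (mixingTime (d ν) ε) ≤ ε := Nat.sInf_mem ⟨_, hmem⟩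
  have hlow : ⌊T ν - α * w ν⌋₊ < mixingTime (d ν) ε := by
    by_contra hle
    have := ka (not_lt.mp hle)
    linarith [k₂.1]
  have e1 : (mixingTime (d ν) ε : ℝ) ≤ T ν + α * w ν :=
    (Nat.cast_le.mpr hup).trans (Nat.floor_le (by positivity))
  have e2 : T ν - α * w ν ≤ mixingTime (d ν) ε := (Nat.lt_of_floor_lt hlow).le
  rw [abs_le]
  constructor <;> linarith

/-- The centre may be moved by a constant number of windows. -/
lemma recentre (h : SharpTransition d T w) (hw : ∀ᶠ ν in atTop, 0 ≤ w ν)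
    (hanti : ∀ᶠ ν in atTop, Antitone (d ν)) {T' : ℕ → ℝ} {C : ℝ}
    (hT' : ∀ᶠ ν in atTop, |T' ν - T ν| ≤ C * w ν) : SharpTransition d T' w := by
  intro ε hε
  obtain ⟨α₀, h₀⟩ := h ε hε
  refine ⟨α₀ + C, fun α hα => ?_⟩
  filter_upwards [h₀ (α - C) (by linarith), hT', hw, hanti] with ν hν hT hw ha
  rw [abs_le] at hT
  exact ⟨hν.1.trans (ha (Nat.floor_mono (by linarith))),
    (ha (Nat.floor_mono (by linarith))).trans hν.2⟩

lemma isEquivalent_of_abs_sub_le (hw : w =o[atTop] T) {T' : ℕ → ℝ} {C : ℝ}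
    (h : ∀ᶠ ν in atTop, |T' ν - T ν| ≤ C * w ν) (hw0 : ∀ᶠ ν in atTop, 0 ≤ w ν) :
    IsEquivalent atTop T' T := by
  refine IsBigO.trans_isLittleO (IsBigO.of_bound C ?_) hw
  filter_upwards [h, hw0] with ν hν h0
  rwa [Pi.sub_apply, Real.norm_eq_abs, Real.norm_eq_abs, abs_of_nonneg h0]

lemma hasCutoffAtWithWindow (h : SharpTransition d T w) (hw : w =o[atTop] T)
    (hT : ∀ᶠ ν in atTop, 0 ≤ T ν) (hw0 : ∀ᶠ ν in atTop, 0 < w ν)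
    (hanti : ∀ᶠ ν in atTop, Antitone (d ν))
    (hd : ∀ᶠ ν in atTop, ∀ t, 0 ≤ d ν t ∧ d ν t ≤ 1) : HasCutoffAtWithWindow d T w := by
  have hw0' := hw0.mono fun ν h => h.le
  have key : ∀ ε : ℝ, 0 < ε → ε < 1 →
      IsEquivalent atTop (fun ν => (mixingTime (d ν) ε : ℝ)) T := fun ε h0 h1 => by
    obtain ⟨C, hC⟩ := h.abs_mixingTime_sub_le hT hw0' hanti h0 h1
    exact isEquivalent_of_abs_sub_le hw hC hw0'
  have hTpos : ∀ᶠ ν in atTop, 0 < T ν := by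
    filter_upwards [hw.bound one_pos, hT, hw0] with ν h1 h2 h3
    rw [Real.norm_eq_abs, Real.norm_eq_abs, abs_of_nonneg h2, abs_of_pos h3] at h1
    linarith
  refine ⟨fun ε h0 h1 => ?_, ?_, h.dropsAt hw hd⟩
  · have k1 := key ε h0 h1
    have k2 := key (1 - ε) (by linarith) (by linarith)
    exact (isEquivalent_iff_tendsto_one
      ((k2.eventually_pos hTpos).mono fun ν h => h.ne')).mp (k1.trans k2.symm)
  · obtain ⟨C, hC⟩ := h.abs_mixingTime_sub_le hT hw0' hanti
      (show (0 : ℝ) < 1 / 4 by norm_num) (by norm_num)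
    exact (h.recentre hw0' hanti hC).dropsAt
      (hw.trans_isEquivalent (key _ (by norm_num) (by norm_num)).symm) hd

end SharpTransition

/-! ### Bounds around the cutoff time -/

namespace BernoulliCube

variable {ι : Type*} [Fintype ι] [DecidableEq ι]

/-- The number of resamplings per coordinate needed for mixing: the first term is the coupon
collector time, the second the time at which the `L²` distance to stationarity becomes small. -/
noncomputable def mixingLog (N ρ : ℝ) : ℝ := min (Real.log N) (Real.log √(N * ρ / (1 - ρ)))

lemma max_lt_one {p : ℝ} (h0 : 0 < p) (h1 : p < 1) : max p (1 - p) < 1 :=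
  max_lt h1 (by linarith)

lemma max_mul_one_sub_max (p : ℝ) : max p (1 - p) * (1 - max p (1 - p)) = p * (1 - p) := by
  rcases le_total p (1 - p) with h | h
  · rw [max_eq_right h]; ring
  · rw [max_eq_left h]

lemma half_log_le_mixingLog {N ρ : ℝ} (hN : 1 ≤ N) (hρ : 1 / 2 ≤ ρ) (hρ1 : ρ < 1) :
    Real.log N / 2 ≤ mixingLog N ρ := by
  have hlog := Real.log_nonneg hN
  refine le_min (by linarith) ?_
  have h : N ≤ N * ρ / (1 - ρ) := by
    rw [le_div_iff₀ (by linarith)]; nlinarith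
  rw [Real.log_sqrt (by linarith)]
  have := Real.log_le_log (by linarith) h
  linarith

omit [DecidableEq ι] in
lemma mul_resampleRate (p : ℝ) [Nonempty ι] :
    2 * max p (1 - p) * Fintype.card ι * resampleRate ι p = 1 := by
  have := half_le_max p
  have hN : (0 : ℝ) < Fintype.card ι := by exact_mod_cast Fintype.card_pos
  exact mul_inv_cancel₀ (by positivity)

omit [DecidableEq ι] in
lemma half_le_card_mul_resampleRate {p : ℝ} (h0 : 0 < p) (h1 : p < 1) [Nonempty ι] :
    1 / 2 ≤ Fintype.card ι * resampleRate ι p := by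
  have hN : (0 : ℝ) < Fintype.card ι := by exact_mod_cast Fintype.card_pos
  have := mul_resampleRate (ι := ι) p
  have h := max_lt_one h0 h1
  have : 0 ≤ Fintype.card ι * resampleRate ι p := mul_nonneg hN.le (resampleRate_nonneg h0)
  nlinarith

lemma worstDist_le_of_mixingLog_add_le {p : ℝ} (h0 : 0 < p) (h1 : p < 1) [Nonempty ι] {s : ℝ}
    {t : ℕ} (ht : mixingLog (Fintype.card ι) (max p (1 - p)) + s ≤ t * resampleRate ι p) :
    worstDist (lazyMetropolis (cubeMass ι p)) (cubeMass ι p) t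
      ≤ Real.exp (-s) + √(Real.exp (Real.exp (-(2 * s))) - 1) := by
  have hN : (0 : ℝ) < Fintype.card ι := by exact_mod_cast Fintype.card_pos
  have hN1 : (1 : ℝ) ≤ Fintype.card ι := by exact_mod_cast Fintype.card_pos
  have hρ := max_pos h0
  have hρ1 := max_lt_one h0 h1
  have hu1 : 0 ≤ 1 - resampleRate ι p := by
    have := card_mul_resampleRate_le_one (ι := ι) p
    nlinarith [resampleRate_nonneg (ι := ι) h0]
  set N : ℝ := (Fintype.card ι : ℝ)
  set ρ := max p (1 - p)
  set u := resampleRate ι p with hu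
  rcases le_total (Real.log N) (Real.log √(N * ρ / (1 - ρ))) with h | h
  · rw [mixingLog, min_eq_left h] at ht
    refine (worstDist_le_card_mul_pow h0 h1 t).trans
      (le_add_of_le_of_nonneg ?_ (Real.sqrt_nonneg _))
    calc N * (1 - u) ^ t ≤ N * Real.exp (-u) ^ t := by
          have := Real.add_one_le_exp (-u)
          gcongr; linarith
      _ = Real.exp (Real.log N + -(t * u)) := by
          rw [Real.exp_add, Real.exp_log hN, ← Real.exp_nat_mul, mul_neg]
      _ ≤ Real.exp (-s) := Real.exp_le_exp.mpr (by linarith)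
  · rw [mixingLog, min_eq_right h, Real.log_sqrt (div_nonneg (by positivity) (by linarith))] at ht
    refine (worstDist_le_sqrt h0 h1 t).trans (le_add_of_nonneg_of_le (Real.exp_pos _).le ?_)
    refine Real.sqrt_le_sqrt (sub_le_sub_right (Real.exp_le_exp.mpr ?_) 1)
    have hpos : 0 < N * ρ / (1 - ρ) := div_pos (by positivity) (by linarith)
    rw [← mul_div_assoc]
    calc N * ρ / (1 - ρ) * Real.exp (-(2 * t * u))
        = Real.exp (Real.log (N * ρ / (1 - ρ)) + -(2 * t * u)) := by
          rw [Real.exp_add, Real.exp_log hpos]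
      _ ≤ Real.exp (-(2 * s)) := Real.exp_le_exp.mpr (by linarith)

/-- Passing from `1 - u` to `exp (-u)` costs only a constant factor up to the cutoff time. -/
lemma exp_le_one_sub_pow {u : ℝ} {t : ℕ} (hu : 0 ≤ u) (hu2 : u ≤ 1 / 2) (h : t * u * u ≤ 1) :
    Real.exp (-(t * u) - 2) ≤ (1 - u) ^ t := by
  have hpos : 0 < 1 - u := by linarith
  have h1 := Real.one_sub_inv_le_log_of_pos hpos
  have h2 : (1 - u)⁻¹ ≤ 1 + u + 2 * u * u := by
    rw [inv_le_comm₀ hpos (by positivity), inv_le_iff_one_le_mul₀ (by positivity)]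
    nlinarith [mul_nonneg hu hu]
  rw [← Real.exp_log (pow_pos hpos t), Real.log_pow]
  refine Real.exp_le_exp.mpr ?_
  have : (t : ℝ) * (-u - 2 * u * u) ≤ t * Real.log (1 - u) :=
    mul_le_mul_of_nonneg_left (by linarith) (Nat.cast_nonneg t)
  linarith

lemma one_sub_le_worstDist_of_le_mixingLog_sub {p : ℝ} (h0 : 0 < p) (h1 : p < 1)
    (hN : 2 ≤ Fintype.card ι) {s : ℝ} (hs : 0 ≤ s) {t : ℕ}
    (ht : t * resampleRate ι p ≤ mixingLog (Fintype.card ι) (max p (1 - p)) - s) :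
    1 - (8 * Real.exp (2 * (2 - s)) + 8 * Real.exp (2 - s))
      ≤ worstDist (lazyMetropolis (cubeMass ι p)) (cubeMass ι p) t := by
  have hN2 : (2 : ℝ) ≤ Fintype.card ι := by exact_mod_cast hN
  have hu0 := resampleRate_nonneg (ι := ι) h0
  have hNu := card_mul_resampleRate_le_one (ι := ι) p
  have hρ2 := half_le_max p
  have hρ1 := max_lt_one h0 h1
  have hv := max_mul_one_sub_max p
  have key := one_sub_le_worstDist (ι := ι) h0 h1 hN t rfl
  set N : ℝ := (Fintype.card ι : ℝ)
  set ρ := max p (1 - p)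
  set u := resampleRate ι p with hu
  set L := mixingLog N ρ with hL
  set K := Real.exp (s - 2) with hK
  have hK0 : 0 < K := Real.exp_pos _
  have hNpos : 0 < N := by linarith
  have hρ0 : 0 < ρ := by linarith
  have hLN : L ≤ Real.log N := min_le_left _ _
  have hlogN : Real.log N ≤ N - 1 := Real.log_le_sub_one_of_pos hNpos
  have hpow : Real.exp (-L) * K ≤ (1 - u) ^ t := by
    refine le_trans ?_ (exp_le_one_sub_pow hu0 (by nlinarith) ?_)
    · rw [hK, ← Real.exp_add]
      exact Real.exp_le_exp.mpr (by linarith)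
    · calc t * u * u ≤ N * u := by gcongr; linarith
        _ ≤ 1 := hNu
  set M := N * ρ * (1 - u) ^ t with hM
  have hMge : N * ρ * (Real.exp (-L) * K) ≤ M := by rw [hM]; gcongr
  -- The two terms of the minimum bound the mean from below by `K / 2`, and by `K` times the
  -- stationary standard deviation.
  have hM1 : K / 2 ≤ M := by
    have : N⁻¹ ≤ Real.exp (-L) := by
      rw [← Real.exp_log (inv_pos.mpr hNpos), Real.log_inv]
      exact Real.exp_le_exp.mpr (by linarith)
    calc K / 2 ≤ ρ * K := by nlinarith
      _ = N * ρ * (N⁻¹ * K) := by field_simp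
      _ ≤ N * ρ * (Real.exp (-L) * K) := by gcongr
      _ ≤ M := hMge
  have hM0 : 0 < M := by linarith
  have hM2 : N * (p * (1 - p)) * K ^ 2 ≤ M ^ 2 := by
    have hr : 0 < N * ρ / (1 - ρ) := div_pos (by positivity) (by linarith)
    have hLr : 2 * L ≤ Real.log (N * ρ / (1 - ρ)) := by
      have : L ≤ Real.log √(N * ρ / (1 - ρ)) := min_le_right _ _
      rw [Real.log_sqrt hr.le] at this
      linarith
    have : (N * ρ / (1 - ρ))⁻¹ ≤ Real.exp (-L) ^ 2 := by
      rw [← Real.exp_log (inv_pos.mpr hr), Real.log_inv, ← Real.exp_nat_mul]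
      exact Real.exp_le_exp.mpr (by push_cast; linarith)
    have h1ρ : (1 - ρ) ≠ 0 := by linarith
    calc N * (p * (1 - p)) * K ^ 2 = (N * ρ) ^ 2 * ((N * ρ / (1 - ρ))⁻¹ * K ^ 2) := by
          rw [← hv]; field_simp
      _ ≤ (N * ρ) ^ 2 * (Real.exp (-L) ^ 2 * K ^ 2) := by gcongr
      _ = (N * ρ * (Real.exp (-L) * K)) ^ 2 := by ring
      _ ≤ M ^ 2 := by gcongr
  have hKinv : Real.exp (2 - s) = K⁻¹ := by rw [hK, ← Real.exp_neg]; congr 1; ring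
  have hKinv2 : Real.exp (2 * (2 - s)) = (K ^ 2)⁻¹ := by
    rw [← inv_pow, ← hKinv, ← Real.exp_nat_mul]; norm_num
  refine le_trans ?_ (key hM0)
  have e : 4 * (2 * (N * (p * (1 - p))) + M) / M ^ 2
      = 8 * (N * (p * (1 - p)) / M ^ 2) + 4 * M⁻¹ := by
    field_simp; ring
  have b1 : N * (p * (1 - p)) / M ^ 2 ≤ (K ^ 2)⁻¹ := by
    rw [div_le_iff₀ (by positivity), inv_mul_eq_div, le_div_iff₀ (by positivity)]
    exact hM2
  have b2 : M⁻¹ ≤ 2 * K⁻¹ := by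
    calc M⁻¹ ≤ (K / 2)⁻¹ := inv_anti₀ (by positivity) hM1
      _ = 2 * K⁻¹ := by field_simp
  rw [e, hKinv, hKinv2]
  linarith

end BernoulliCube

/-! ### The Erdős–Rényi model -/

namespace ErdosRenyi

open BernoulliCube

lemma card_potentialEdge (ν : ℕ) : Fintype.card (PotentialEdge ν) = ν.choose 2 := by
  rw [Sym2.card_subtype_not_diag, Fintype.card_fin]

lemma erdosRenyi_eq_cubeMass (ν : ℕ) (p : ℝ) :
    erdosRenyi ν p = cubeMass (PotentialEdge ν) p := by
  funext x
  have h : (Finset.univ.filter fun e => ¬ x e = true).card = ν.choose 2 - numEdges x := by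
    rw [← card_potentialEdge, numEdges, ← Finset.card_univ,
      ← Finset.card_filter_add_card_filter_not (s := Finset.univ) (fun e => x e = true)]
    omega
  simp only [cubeMass, bit]
  rw [Finset.prod_ite, Finset.prod_const, Finset.prod_const, h]
  rfl

lemma le_choose_two {ν : ℕ} (h : 3 ≤ ν) : ν ≤ ν.choose 2 := by
  induction ν, h using Nat.le_induction with
  | base => decide
  | succ k hk ih =>
    have : (k + 1).choose 2 = k + k.choose 2 := by
      rw [Nat.choose_succ_succ' k 1, Nat.choose_one_right]
    omega

lemma nonempty_potentialEdge {ν : ℕ} (h : 3 ≤ ν) : Nonempty (PotentialEdge ν) := by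
  rw [← Fintype.card_pos_iff, card_potentialEdge]
  have := le_choose_two h
  omega

lemma erdosRenyiDist_mem_Icc {p : ℝ} (h0 : 0 < p) (h1 : p < 1) (ν t : ℕ) :
    0 ≤ erdosRenyiDist ν p t ∧ erdosRenyiDist ν p t ≤ 1 := by
  rw [erdosRenyiDist, erdosRenyi_eq_cubeMass]
  exact ⟨FiniteChain.worstDist_nonneg _ _ _,
    FiniteChain.worstDist_le_one (lazyMetropolis_nonneg h0 h1) (lazyMetropolis_row_sum h0 h1)
      (fun x => (cubeMass_pos h0 h1 x).le) t⟩

lemma erdosRenyiDist_antitone {p : ℝ} (h0 : 0 < p) (h1 : p < 1) (ν : ℕ) :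
    Antitone (erdosRenyiDist ν p) := by
  have h := FiniteChain.worstDist_antitone (cubeMass (PotentialEdge ν) p)
    (lazyMetropolis_nonneg h0 h1) (lazyMetropolis_row_sum h0 h1)
  intro s t hst
  simpa only [erdosRenyiDist, erdosRenyi_eq_cubeMass] using h hst

/-- The time at which the cutoff occurs. -/
noncomputable def cutoffTime (ν : ℕ) (p : ℝ) : ℝ :=
  2 * max p (1 - p) * ν.choose 2 * mixingLog (ν.choose 2) (max p (1 - p))

lemma half_log_mul_le_cutoffTime {p : ℝ} (h0 : 0 < p) (h1 : p < 1) {ν : ℕ} (hν : 3 ≤ ν) :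
    Real.log (ν.choose 2) / 2 * ν.choose 2 ≤ cutoffTime ν p := by
  have hn : (1 : ℝ) ≤ ν.choose 2 := by
    have := le_choose_two hν
    exact_mod_cast (by omega : 1 ≤ ν.choose 2)
  have hρ := half_le_max p
  have hL := half_log_le_mixingLog hn hρ (max_lt_one h0 h1)
  have hlog := Real.log_nonneg hn
  rw [cutoffTime]
  calc Real.log (ν.choose 2) / 2 * ν.choose 2
      ≤ mixingLog (ν.choose 2) (max p (1 - p)) * ν.choose 2 := by gcongr
    _ = 1 * ν.choose 2 * mixingLog (ν.choose 2) (max p (1 - p)) := by ring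
    _ ≤ _ := by gcongr <;> linarith

lemma erdosRenyiDist_add_le {p : ℝ} (h0 : 0 < p) (h1 : p < 1) {ν : ℕ} (hν : 3 ≤ ν) {α : ℝ}
    (hα : 1 ≤ α) :
    erdosRenyiDist ν p ⌊cutoffTime ν p + α * ν.choose 2⌋₊
      ≤ Real.exp (-((α - 1) / 2)) + √(Real.exp (Real.exp (-(2 * ((α - 1) / 2)))) - 1) := by
  have := nonempty_potentialEdge hν
  rw [erdosRenyiDist, erdosRenyi_eq_cubeMass]
  refine worstDist_le_of_mixingLog_add_le h0 h1 ?_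
  have a1 := mul_resampleRate (ι := PotentialEdge ν) p
  have a2 := half_le_card_mul_resampleRate (ι := PotentialEdge ν) h0 h1
  have hu := resampleRate_nonneg (ι := PotentialEdge ν) h0
  have hn : (1 : ℝ) ≤ ν.choose 2 := by
    have := le_choose_two hν
    exact_mod_cast (by omega : 1 ≤ ν.choose 2)
  have hfl := Nat.lt_floor_add_one (cutoffTime ν p + α * ν.choose 2)
  rw [card_potentialEdge] at *
  set u := resampleRate (PotentialEdge ν) p
  set t : ℕ := ⌊cutoffTime ν p + α * ν.choose 2⌋₊
  have b1 : cutoffTime ν p + (α - 1) * ν.choose 2 ≤ t := by linarith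
  have b2 := mul_le_mul_of_nonneg_right b1 hu
  have b3 : cutoffTime ν p * u = mixingLog (ν.choose 2) (max p (1 - p)) := by
    rw [cutoffTime]; linear_combination mixingLog (ν.choose 2) (max p (1 - p)) * a1
  have b4 := mul_le_mul_of_nonneg_left a2 (sub_nonneg.mpr hα)
  linarith

lemma one_sub_le_erdosRenyiDist_sub {p : ℝ} (h0 : 0 < p) (h1 : p < 1) {ν : ℕ} (hν : 3 ≤ ν) {α : ℝ}
    (hα : 0 ≤ α) (hT : α * ν.choose 2 ≤ cutoffTime ν p) :
    1 - (8 * Real.exp (2 * (2 - α / 2)) + 8 * Real.exp (2 - α / 2))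
      ≤ erdosRenyiDist ν p ⌊cutoffTime ν p - α * ν.choose 2⌋₊ := by
  have := nonempty_potentialEdge hν
  rw [erdosRenyiDist, erdosRenyi_eq_cubeMass]
  have hn := le_choose_two hν
  refine one_sub_le_worstDist_of_le_mixingLog_sub h0 h1 (by rw [card_potentialEdge]; omega)
    (by linarith) ?_
  have a1 := mul_resampleRate (ι := PotentialEdge ν) p
  have a2 := half_le_card_mul_resampleRate (ι := PotentialEdge ν) h0 h1
  have hu := resampleRate_nonneg (ι := PotentialEdge ν) h0
  have hfl := Nat.floor_le (sub_nonneg.mpr hT)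
  rw [card_potentialEdge] at *
  set u := resampleRate (PotentialEdge ν) p
  set t : ℕ := ⌊cutoffTime ν p - α * ν.choose 2⌋₊
  have b2 := mul_le_mul_of_nonneg_right hfl hu
  have b3 : cutoffTime ν p * u = mixingLog (ν.choose 2) (max p (1 - p)) := by
    rw [cutoffTime]; linear_combination mixingLog (ν.choose 2) (max p (1 - p)) * a1
  have b4 := mul_le_mul_of_nonneg_left a2 hα
  linarith

lemma tendsto_choose_two : Tendsto (fun ν : ℕ => (ν.choose 2 : ℝ)) atTop atTop := by
  refine tendsto_atTop_mono' atTop ?_ (tendsto_natCast_atTop_atTop (R := ℝ))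
  filter_upwards [eventually_ge_atTop 3] with ν hν
  exact_mod_cast le_choose_two hν

lemma eventually_mul_choose_two_le_cutoffTime {p : ℕ → ℝ}
    (hp : ∀ ν : ℕ, 2 ≤ ν → 0 < p ν ∧ p ν < 1) (C : ℝ) :
    ∀ᶠ ν in atTop, C * (ν.choose 2 : ℝ) ≤ cutoffTime ν (p ν) := by
  filter_upwards [eventually_ge_atTop 3,
    (Real.tendsto_log_atTop.comp tendsto_choose_two).eventually_ge_atTop (2 * C)] with ν hν hC
  obtain ⟨h0, h1⟩ := hp ν (by omega)
  have hC : 2 * C ≤ Real.log (ν.choose 2) := hC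
  refine le_trans ?_ (half_log_mul_le_cutoffTime h0 h1 hν)
  exact mul_le_mul_of_nonneg_right (by linarith) (Nat.cast_nonneg _)

lemma choose_two_isLittleO_cutoffTime {p : ℕ → ℝ}
    (hp : ∀ ν : ℕ, 2 ≤ ν → 0 < p ν ∧ p ν < 1) :
    (fun ν : ℕ => (ν.choose 2 : ℝ)) =o[atTop] fun ν => cutoffTime ν (p ν) := by
  refine isLittleO_iff.mpr fun c hc => ?_
  filter_upwards [eventually_mul_choose_two_le_cutoffTime hp c⁻¹] with ν hν
  rw [Real.norm_of_nonneg (Nat.cast_nonneg _), Real.norm_eq_abs]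
  rw [inv_mul_le_iff₀ hc] at hν
  exact hν.trans (by gcongr; exact le_abs_self _)

lemma sharpTransition {p : ℕ → ℝ} (hp : ∀ ν : ℕ, 2 ≤ ν → 0 < p ν ∧ p ν < 1) :
    SharpTransition (fun ν => erdosRenyiDist ν (p ν)) (fun ν => cutoffTime ν (p ν))
      fun ν => (ν.choose 2 : ℝ) := by
  intro ε hε
  have l1 : Tendsto (fun α : ℝ => 8 * Real.exp (2 * (2 - α / 2)) + 8 * Real.exp (2 - α / 2))
      atTop (𝓝 0) := by
    have h : Tendsto (fun α : ℝ => 2 - α / 2) atTop atBot :=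
      tendsto_atBot_add_const_left _ 2
        (tendsto_neg_atTop_atBot.comp (tendsto_id.atTop_div_const two_pos))
    have h2 := Real.tendsto_exp_atBot.comp (h.const_mul_atBot (two_pos (α := ℝ)))
    have h1 := Real.tendsto_exp_atBot.comp h
    simpa using (h2.const_mul 8).add (h1.const_mul 8)
  have l2 : Tendsto (fun α : ℝ => Real.exp (-((α - 1) / 2))
      + √(Real.exp (Real.exp (-(2 * ((α - 1) / 2)))) - 1)) atTop (𝓝 0) := by
    have h : Tendsto (fun α : ℝ => (α - 1) / 2) atTop atTop :=
      (tendsto_atTop_add_const_right _ (-1) tendsto_id).atTop_div_const two_pos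
    have h1 := Real.tendsto_exp_neg_atTop_nhds_zero.comp h
    have h2 := Real.tendsto_exp_neg_atTop_nhds_zero.comp (h.const_mul_atTop (two_pos (α := ℝ)))
    have h3 := (((Real.continuous_exp.tendsto 0).comp h2).sub_const 1).sqrt
    simpa using h1.add h3
  obtain ⟨α₀, hα₀⟩ := eventually_atTop.mp
    ((l1.eventually_le_const hε).and (l2.eventually_le_const hε))
  refine ⟨max α₀ 1, fun α hα => ?_⟩
  obtain ⟨k1, k2⟩ := hα₀ α ((le_max_left _ _).trans hα)
  have hα1 : 1 ≤ α := (le_max_right _ _).trans hα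
  filter_upwards [eventually_ge_atTop 3, eventually_mul_choose_two_le_cutoffTime hp α] with ν hν hT
  obtain ⟨h0, h1⟩ := hp ν (by omega)
  exact ⟨le_trans (by linarith) (one_sub_le_erdosRenyiDist_sub h0 h1 hν (by linarith) hT),
    (erdosRenyiDist_add_le h0 h1 hν hα1).trans k2⟩

end ErdosRenyi

theorem mainTheorem4 (p ρ n : ℕ → ℝ)
    (hp : ∀ ν : ℕ, 2 ≤ ν → 0 < p ν ∧ p ν < 1)
    (hρ : ∀ ν : ℕ, ρ ν = max (p ν) (1 - p ν))
    (hn : ∀ ν : ℕ, n ν = (ν.choose 2 : ℝ)) :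
    HasCutoffAtWithWindow (fun ν => erdosRenyiDist ν (p ν))
      (fun ν => 2 * ρ ν * n ν *
        min (Real.log (n ν)) (Real.log (Real.sqrt (n ν * ρ ν / (1 - ρ ν)))))
      n := by
  obtain rfl : ρ = fun ν => max (p ν) (1 - p ν) := funext hρ
  obtain rfl : n = fun ν => (ν.choose 2 : ℝ) := funext hn
  have h2 : ∀ᶠ ν : ℕ in atTop, 2 ≤ ν := eventually_ge_atTop 2
  exact (ErdosRenyi.sharpTransition hp).hasCutoffAtWithWindow
    (ErdosRenyi.choose_two_isLittleO_cutoffTime hp)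
    ((ErdosRenyi.eventually_mul_choose_two_le_cutoffTime hp 0).mono fun ν h => by simpa using h)
    (ErdosRenyi.tendsto_choose_two.eventually_gt_atTop 0)
    (h2.mono fun ν h => ErdosRenyi.erdosRenyiDist_antitone (hp ν h).1 (hp ν h).2 ν)
    (h2.mono fun ν h t => ErdosRenyi.erdosRenyiDist_mem_Icc (hp ν h).1 (hp ν h).2 ν t)
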